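/- A $\mathbb Q$-polygon is a subset $\Delta\subset\mathbb R^2$ with non-empty interior $\Delta^\circ$ that is the intersection of finitely many (at least one) closed half-planes whose boundary lines have rational slope (vertical lines included). A $\Delta$-tropical series is a function $f:\Delta\to\mathbb R_{\ge 0}$ with $f|_{\partial\Delta}=0$ of the form $$f(x,y)=\inf_{(i,j)\in A}(ix+jy+a_{ij}),\qquad a_{ij}\in\mathbb R,$$ for some non-empty, possibly infinite $A\subset\mathbb Z^2$. The $\Delta$-tropical curve $C(f)\subset\Delta^\circ$ is the set of points of $\Delta^\circ$ at which $f$ is not smooth. A point $z\in C(f)$ is an internal point of an edge of weight $m\in\mathbb Z_{>0}$ if near $z$ one has $$f(x,y)=\min\bigl(0,\,m(px+qy+e)\bigr)+(nx+ly+k)$$ for some $p,q,n,l\in\mathbb Z$ with $\gcd(p,q)=1$ and some $e,k\in\mathbb R$. The edges of $C(f)$ are the connected components of the set of such points (for all $m$); each edge $L$ is an interval of rational slope and has a well-defined weight $m_L$. The tropical symplectic area of an interval $L$ of rational slope is $\mathrm{Area}(L)=\|L\|\cdot\|v\|$, where $\|L\|$ is its Euclidean length and $\|v\|$ is the Euclidean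 norm of a primitive integer vector $v$ parallel to $L$; the tropical symplectic area of $C(f)$ is $$\mathrm{Area}(C(f))=\sum_{L}m_L\,\mathrm{Area}(L)\in[0,\infty],$$ the sum being over all edges $L$ of $C(f)$. Let $\Delta$ be a compact $\mathbb Q$-polygon, let $P\subset\Delta^\circ$ be a finite set, and let $f_{\Delta,P}$ be the pointwise infimum of all $\Delta$-tropical series that are not smooth at each point of $P$. Then $f_{\Delta,P}$ is itself a $\Delta$-tropical series that is not smooth at each point of $P$, and its curve has the minimal tropical symplectic area among all $\Delta$-tropical curves passing through $P$: for every $\Delta$-tropical series $g$ with $P\subset C(g)$, $$\mathrm{Area}(C(f_{\Delta,P}))\le \mathrm{Area}(C(g)).$$ -/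

import Mathlib

open Set Topology MeasureTheory
open scoped ContDiff ENNReal

noncomputable section

namespace TropicalSeries

/-- The plane `ℝ²` with its Euclidean metric. -/
abbrev Plane : Type := EuclideanSpace ℝ (Fin 2)

/-- The vector of `ℝ²` given by an integer vector. -/
def intVec (v : ℤ × ℤ) : Plane := !₂[(v.1 : ℝ), (v.2 : ℝ)]

/-- The monomial `i x + j y + a` at the point `z = (x, y)`, where `v = (i, j)`. -/
def monomial (v : ℤ × ℤ) (a : ℝ) (z : Plane) : ℝ := (v.1 : ℝ) * z 0 + (v.2 : ℝ) * z 1 + a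

/-- A `ℚ`-polygon: the intersection of finitely many (at least one) closed half-planes
`i x + j y + a ≥ 0` with rational slopes, `(i, j) ∈ ℤ² \ {0}`, with non-empty interior. -/
def IsQPolygon (Δ : Set Plane) : Prop :=
  (∃ H : Finset ((ℤ × ℤ) × ℝ), H.Nonempty ∧ (∀ h ∈ H, h.1 ≠ 0) ∧
      Δ = {z | ∀ h ∈ H, 0 ≤ monomial h.1 h.2 z}) ∧
    (interior Δ).Nonempty

/-- `f` is an `Ω`-tropical series: on `Ω` it is non-negative, it vanishes on `∂Ω`, and on `Ω` it is
the pointwise infimum of a (possibly infinite) family of monomials, with at most one coefficient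
for each exponent `(i, j)`. Only the values of `f` on `Ω` matter. -/
def IsSeries (Ω : Set Plane) (f : Plane → ℝ) : Prop :=
  (∀ z ∈ Ω, 0 ≤ f z) ∧ (∀ z ∈ frontier Ω, f z = 0) ∧
    ∃ (A : Set (ℤ × ℤ)) (a : ℤ × ℤ → ℝ),
      ∀ z ∈ Ω, IsGLB ((fun v => monomial v (a v) z) '' A) (f z)

/-- The tropical curve `C(f)` in `Ω`: the points of the interior of `Ω` where `f` is not smooth. -/
def curve (Ω : Set Plane) (f : Plane → ℝ) : Set Plane :=
  {z | z ∈ interior Ω ∧ ¬ ContDiffAt ℝ ∞ f z}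

/-- The `Ω`-tropical series that are not smooth at each of the points of `P`. -/
def seriesThrough (Ω P : Set Plane) : Set (Plane → ℝ) :=
  {g | IsSeries Ω g ∧ P ⊆ curve Ω g}

/-- The function `f_{Ω,P}`: the pointwise infimum of all `Ω`-tropical series that are not smooth
at each of the points of `P`. (Relevant on `Ω` only, where the values are bounded below by `0`.) -/
def minSeries (Ω P : Set Plane) (z : Plane) : ℝ :=
  sInf ((fun g : Plane → ℝ => g z) '' seriesThrough Ω P)

/-- Near the point `z` of the curve, `f` is `min(0, m X)` up to adding an integral affine function,
where `X = p x + q y + e` is the first coordinate of an integral affine change of coordinates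
(a row `(p, q)` is completed to an integer matrix of determinant one iff `p, q` are coprime). -/
def HasWeightAt (Ω : Set Plane) (f : Plane → ℝ) (m : ℕ) (z : Plane) : Prop :=
  z ∈ curve Ω f ∧ ∃ (u v : ℤ × ℤ) (e k : ℝ), IsCoprime u.1 u.2 ∧
    f =ᶠ[𝓝 z] fun w => min 0 ((m : ℝ) * monomial u e w) + monomial v k w

/-- The points of the curve that are internal points of an edge; the other points of the curve are
its vertices. -/
def edgePoints (Ω : Set Plane) (f : Plane → ℝ) : Set Plane :=
  {z | ∃ m : ℕ, 0 < m ∧ HasWeightAt Ω f m z}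

/-- The (open) edges of the curve: the connected components of the curve minus its vertices. -/
def edges (Ω : Set Plane) (f : Plane → ℝ) : Set (Set Plane) :=
  {L | ∃ z ∈ edgePoints Ω f, L = connectedComponentIn (edgePoints Ω f) z}

/-- The weight of an edge: the number `m` such that `f` is `min(0, m X)` in suitable coordinates
near each internal point of the edge. -/
def edgeWeight (Ω : Set Plane) (f : Plane → ℝ) (L : Set Plane) : ℕ :=
  sInf {m : ℕ | ∀ z ∈ L, HasWeightAt Ω f m z}

/-- `v` is a primitive integer vector parallel to `L`. -/
def IsPrimitiveDirection (L : Set Plane) (v : ℤ × ℤ) : Prop :=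
  IsCoprime v.1 v.2 ∧ ∀ x ∈ L, ∀ y ∈ L, ∃ t : ℝ, y - x = t • intVec v

/-- The tropical symplectic area of an interval `L` with rational slope: its Euclidean length
times the Euclidean length of a primitive integer vector parallel to `L`. (For a non-degenerate
`L` the vector is unique up to sign, so that the infimum is over a single value.) -/
def intervalArea (L : Set Plane) : ℝ≥0∞ :=
  ⨅ (v : ℤ × ℤ) (_ : IsPrimitiveDirection L v), μH[1] L * ‖intVec v‖ₑ

/-- The tropical symplectic area of the curve `C(f)`, possibly infinite: the sum of the areas of
its edges taken with their weights. -/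
def area (Ω : Set Plane) (f : Plane → ℝ) : ℝ≥0∞ :=
  ∑' L : edges Ω f, intervalArea L.1 * (edgeWeight Ω f L.1 : ℝ≥0∞)

end TropicalSeries

end

/-!
The area of a tropical curve is a monotone function of the series. An edge of weight `m` with
primitive normal vector `u` is a jump `m u` of the gradient of `f`, and `‖u‖` is also the length of
the primitive vector along the edge, so that the area of the curve is the total mass of the
distribution `-(∂₀² f + ∂₁² f)`. By slicing, this is the sum over the two coordinate directions of
the integral, over all lines in that direction, of the total slope variation of the concave
restriction of `f` to the line (`area_eq_sum_lintegral_slopeSet`).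

The total slope variation is encoded as the Lebesgue measure of the set of supergradients of the
restriction (`slopeSet`). Since `f` vanishes on the boundary, this set consists of the `σ` such that
`f - σ zᵢ` exceeds its boundary values at some interior point of the slice, a condition that can
only become weaker when `f` increases (`slopeSet_mono`). On a generic line the supergradient set is,
up to integers, the disjoint union of the slope intervals at the edges that the line crosses
(`volume_slopeSet`): the maximum point of `f - σ zᵢ` on the line determines the edge. The lines that
have to be excluded pass through points where three monomials with non-collinear exponents agree,
and there are only countably many such points.

The edges themselves are handled through the pairs of exponents active on their two sides. By
concavity the points with a given pair form a convex set (`convex_pairEdge`), which is relatively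
open in the set of all internal points of edges; hence these sets are the connected components
(`connectedComponentIn_edgePoints`).

It remains to see that `minSeries` is a series through the given points. It is one because an
infimum of infima of monomials is again an infimum of monomials, and it is not smooth at the points
because integral gradients that differ do so by a definite amount (`subset_curve_minSeries`).
That some series passes through the points is shown in `seriesThrough_nonempty`.
-/

namespace TropicalSeries

/-! ### Monomials -/

lemma monomial_add (v : ℤ × ℤ) (a : ℝ) (z δ : Plane) :
    monomial v a (z + δ) = monomial v a z + monomial v 0 δ := by
  simp only [monomial, PiLp.add_apply]; ring

lemma monomial_smul (v : ℤ × ℤ) (t : ℝ) (δ : Plane) :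
    monomial v 0 (t • δ) = t * monomial v 0 δ := by
  simp only [monomial, PiLp.smul_apply, smul_eq_mul]; ring

lemma monomial_combo (v : ℤ × ℤ) (a : ℝ) (z w : Plane) {s t : ℝ} (h : s + t = 1) :
    monomial v a (s • z + t • w) = s * monomial v a z + t * monomial v a w := by
  obtain rfl : s = 1 - t := by linarith
  simp only [monomial, PiLp.add_apply, PiLp.smul_apply, smul_eq_mul]; ring

lemma monomial_sub_monomial (v v' : ℤ × ℤ) (a a' : ℝ) (z : Plane) :
    monomial v a z - monomial v' a' z = monomial (v - v') (a - a') z := by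
  simp only [monomial, Prod.fst_sub, Prod.snd_sub, Int.cast_sub]; ring

lemma monomial_eq_add (v : ℤ × ℤ) (a : ℝ) (z : Plane) :
    monomial v a z = monomial v 0 z + a := by
  simp only [monomial]; ring

lemma monomial_single (v : ℤ × ℤ) (i : Fin 2) (t : ℝ) :
    monomial v 0 (EuclideanSpace.single i t) = t * intVec v i := by
  fin_cases i <;> simp [monomial, intVec, mul_comm]

lemma contDiff_monomial (v : ℤ × ℤ) (a : ℝ) : ContDiff ℝ ∞ (monomial v a) := by
  unfold monomial; fun_prop

lemma continuous_monomial (v : ℤ × ℤ) (a : ℝ) : Continuous (monomial v a) :=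
  (contDiff_monomial v a).continuous

lemma intVec_injective {v w : ℤ × ℤ} (h : ∀ i, intVec v i = intVec w i) : v = w := by
  have h0 := h 0
  have h1 := h 1
  simp only [intVec, PiLp.toLp_apply, Matrix.cons_val_zero, Matrix.cons_val_one] at h0 h1
  exact Prod.ext (by exact_mod_cast h0) (by exact_mod_cast h1)

lemma intVec_apply_eq_intCast (v : ℤ × ℤ) (i : Fin 2) : ∃ n : ℤ, intVec v i = n := by
  fin_cases i
  · exact ⟨v.1, by simp [intVec]⟩
  · exact ⟨v.2, by simp [intVec]⟩

lemma intVec_sub_apply (v w : ℤ × ℤ) (i : Fin 2) :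
    intVec (v - w) i = intVec v i - intVec w i := by
  fin_cases i <;> simp [intVec]

/-- A monomial that is non-negative on a disc is bounded below at its centre by the size of its
slopes. This is what makes infima of monomials with integral exponents locally finite. -/
lemma abs_slope_mul_le {v : ℤ × ℤ} {a r : ℝ} {z : Plane} (hr : 0 < r)
    (h : ∀ w ∈ Metric.ball z r, 0 ≤ monomial v a w) (i : Fin 2) :
    |intVec v i| * (r / 2) ≤ monomial v a z := by
  have key : ∀ t : ℝ, |t| < r → 0 ≤ monomial v a z + t * intVec v i := by
    intro t ht
    have := h (z + EuclideanSpace.single i t) (by simpa using ht)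
    rwa [monomial_add, monomial_single] at this
  have h1 := key (r / 2) (by rw [abs_of_pos] <;> linarith)
  have h2 := key (-(r / 2)) (by rw [abs_neg, abs_of_pos] <;> linarith)
  rcases abs_cases (intVec v i) with ⟨h, -⟩ | ⟨h, -⟩ <;> rw [h] <;> linarith

/-- Two monomials that touch a differentiable function from above at the same point have the same
exponent, namely the gradient of the function. -/
lemma exponent_eq_of_touching {f : Plane → ℝ} {z : Plane} (hf : DifferentiableAt ℝ f z)
    {v v' : ℤ × ℤ} {a a' : ℝ} (h : ∀ᶠ w in 𝓝 z, f w ≤ monomial v a w) (hz : f z = monomial v a z)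
    (h' : ∀ᶠ w in 𝓝 z, f w ≤ monomial v' a' w) (hz' : f z = monomial v' a' z) : v = v' := by
  set D : ℤ × ℤ → Plane →L[ℝ] ℝ := fun u =>
    (u.1 : ℝ) • EuclideanSpace.proj 0 + (u.2 : ℝ) • EuclideanSpace.proj 1
  have crit : ∀ u b, (∀ᶠ w in 𝓝 z, f w ≤ monomial u b w) → f z = monomial u b z →
      D u = fderiv ℝ f z := by
    intro u b hu hub
    have der : HasFDerivAt (monomial u b) (D u) z := (D u).hasFDerivAt.add_const b
    have hmin : IsLocalMin (fun w => monomial u b w - f w) z := by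
      filter_upwards [hu] with w hw
      linarith
    exact sub_eq_zero.1 (hmin.hasFDerivAt_eq_zero (der.sub hf.hasFDerivAt))
  have e := (crit v a h hz).trans (crit v' a' h' hz').symm
  have e0 := DFunLike.congr_fun e (EuclideanSpace.single 0 1)
  have e1 := DFunLike.congr_fun e (EuclideanSpace.single 1 1)
  simp [D] at e0 e1
  exact Prod.ext e0 e1

/-! ### Tropical series -/

section Series

variable {Ω : Set Plane} {f : Plane → ℝ} {A : Set (ℤ × ℤ)} {a : ℤ × ℤ → ℝ}

lemma le_monomial_of_isGLB (h : ∀ z ∈ Ω, IsGLB ((fun v => monomial v (a v) z) '' A) (f z))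
    {v : ℤ × ℤ} (hv : v ∈ A) {z : Plane} (hz : z ∈ Ω) : f z ≤ monomial v (a v) z :=
  (h z hz).1 (mem_image_of_mem _ hv)

/-- An infimum of monomials with integral exponents that is non-negative on `Ω` is, near an interior
point `z` of `Ω`, the minimum of finitely many monomials, all attaining the value at `z`. -/
lemma exists_finite_active (h : ∀ z ∈ Ω, IsGLB ((fun v => monomial v (a v) z) '' A) (f z))
    (h0 : ∀ z ∈ Ω, 0 ≤ f z) {z : Plane} (hz : z ∈ interior Ω) :
    ∃ F : Finset (ℤ × ℤ), (∀ v ∈ F, v ∈ A ∧ monomial v (a v) z = f z) ∧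
      ∀ᶠ w in 𝓝 z, ∃ v ∈ F, monomial v (a v) w = f w := by
  classical
  obtain ⟨r, hr, hball⟩ := Metric.isOpen_iff.1 isOpen_interior z hz
  have hballΩ : Metric.ball z r ⊆ Ω := hball.trans interior_subset
  obtain ⟨v₀, hv₀⟩ : A.Nonempty := by
    by_contra hA
    have := h z (interior_subset hz)
    rw [not_nonempty_iff_eq_empty.1 hA, image_empty, isGLB_empty_iff] at this
    have := this (f z + 1)
    linarith
  set K := monomial v₀ (a v₀) z + 1
  have hK : ∀ᶠ w in 𝓝 z, monomial v₀ (a v₀) w < K :=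
    (continuous_monomial v₀ (a v₀)).continuousAt.eventually_lt continuousAt_const (by simp [K])
  -- the exponents whose monomial can take a value at most `K` at distance less than `r / 2`
  have hfin : {v : ℤ × ℤ | ∀ i, |intVec v i| * (r / 2 / 2) ≤ K}.Finite := by
    obtain ⟨N, hN⟩ := exists_nat_gt (K / (r / 2 / 2))
    refine (Set.finite_Icc ((-N, -N) : ℤ × ℤ) (N, N)).subset fun v hv => ?_
    have hb : ∀ i, |intVec v i| ≤ N := fun i =>
      ((le_div_iff₀ (by linarith)).2 (hv i)).trans hN.le
    have b0 := abs_le.1 (hb 0)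
    have b1 := abs_le.1 (hb 1)
    simp only [intVec, PiLp.toLp_apply, Matrix.cons_val_zero, Matrix.cons_val_one] at b0 b1
    exact ⟨⟨by exact_mod_cast b0.1, by exact_mod_cast b1.1⟩,
      ⟨by exact_mod_cast b0.2, by exact_mod_cast b1.2⟩⟩
  set G : Finset (ℤ × ℤ) := hfin.toFinset.filter (· ∈ A)
  have hG : ∀ᶠ w in 𝓝 z, ∃ v ∈ G, monomial v (a v) w = f w := by
    filter_upwards [hK, Metric.ball_mem_nhds z (half_pos hr)] with w hwK hw
    have hsub : Metric.ball w (r / 2) ⊆ Metric.ball z r := by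
      apply Metric.ball_subset_ball'
      have := Metric.mem_ball.1 hw
      linarith
    have hwΩ : w ∈ Ω := hballΩ (hsub (Metric.mem_ball_self (half_pos hr)))
    have hmem : ∀ v ∈ A, monomial v (a v) w ≤ K → v ∈ G := by
      intro v hv hvK
      refine Finset.mem_filter.2 ⟨hfin.mem_toFinset.2 fun i => ?_, hv⟩
      refine (abs_slope_mul_le (half_pos hr) (fun w' hw' => ?_) i).trans hvK
      exact (h0 w' (hballΩ (hsub hw'))).trans (le_monomial_of_isGLB h hv (hballΩ (hsub hw')))
    obtain ⟨v, hvG, hv⟩ := G.exists_min_image (fun v => monomial v (a v) w)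
      ⟨v₀, hmem v₀ hv₀ hwK.le⟩
    refine ⟨v, hvG, le_antisymm ((h w hwΩ).2 ?_)
      (le_monomial_of_isGLB h (Finset.mem_filter.1 hvG).2 hwΩ)⟩
    rintro _ ⟨u, hu, rfl⟩
    by_cases huK : monomial u (a u) w ≤ K
    · exact hv u (hmem u hu huK)
    · exact (hv v₀ (hmem v₀ hv₀ hwK.le)).trans (hwK.le.trans (not_le.1 huK).le)
  obtain ⟨v₁, hv₁G, hv₁⟩ := hG.self_of_nhds
  refine ⟨G.filter fun v => monomial v (a v) z = f z,
    fun v hv => ⟨(Finset.mem_filter.1 (Finset.mem_filter.1 hv).1).2,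
      (Finset.mem_filter.1 hv).2⟩, ?_⟩
  have hinact : ∀ᶠ w in 𝓝 z, ∀ v ∈ G, monomial v (a v) z ≠ f z →
      monomial v₁ (a v₁) w < monomial v (a v) w := by
    rw [Filter.eventually_all_finset]
    intro v hv
    by_cases hvz : monomial v (a v) z = f z
    · exact Filter.Eventually.of_forall fun w h => absurd hvz h
    have hlt : monomial v₁ (a v₁) z < monomial v (a v) z := by
      rw [hv₁]
      exact lt_of_le_of_ne (le_monomial_of_isGLB h (Finset.mem_filter.1 hv).2
        (interior_subset hz)) (Ne.symm hvz)
    filter_upwards [(continuous_monomial v₁ (a v₁)).continuousAt.eventually_lt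
      (continuous_monomial v (a v)).continuousAt hlt] with w hw _ using hw
  filter_upwards [hG, hinact, isOpen_interior.mem_nhds hz] with w ⟨v, hvG, hv⟩ hw hwΩ
  refine ⟨v, Finset.mem_filter.2 ⟨hvG, ?_⟩, hv⟩
  by_contra hne
  have h1 := hw v hvG hne
  have h2 := le_monomial_of_isGLB h (Finset.mem_filter.1 hv₁G).2 (interior_subset hwΩ)
  linarith

/-- At an interior point where a tropical series is not given by a single monomial, two monomials
with different exponents are active. -/
lemma exists_two_active (h : ∀ z ∈ Ω, IsGLB ((fun v => monomial v (a v) z) '' A) (f z))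
    (h0 : ∀ z ∈ Ω, 0 ≤ f z) {z : Plane} (hz : z ∈ interior Ω)
    (hn : ¬ ∃ v b, f =ᶠ[𝓝 z] monomial v b) :
    ∃ v ∈ A, ∃ v' ∈ A, v ≠ v' ∧ monomial v (a v) z = f z ∧ monomial v' (a v') z = f z := by
  obtain ⟨F, hF, hev⟩ := exists_finite_active h h0 hz
  by_contra! hcon
  apply hn
  obtain ⟨v, hv, hvz⟩ := hev.self_of_nhds
  refine ⟨v, a v, ?_⟩
  filter_upwards [hev] with w ⟨u, hu, huw⟩
  by_cases e : v = u
  · rw [e, huw]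
  · exact absurd (hF u hu).2 (hcon v (hF v hv).1 u (hF u hu).1 e hvz)

/-- A tropical series is smooth at an interior point only if it is a single monomial nearby. -/
lemma exists_eventuallyEq_monomial (hf : IsSeries Ω f) {z : Plane} (hz : z ∈ interior Ω)
    (hd : ContDiffAt ℝ ∞ f z) : ∃ v b, f =ᶠ[𝓝 z] monomial v b := by
  obtain ⟨h0, -, A, a, h⟩ := hf
  by_contra hn
  obtain ⟨v, hv, v', hv', hne, hvz, hvz'⟩ := exists_two_active h h0 hz hn
  have hnear : ∀ u ∈ A, ∀ᶠ w in 𝓝 z, f w ≤ monomial u (a u) w := fun u hu => by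
    filter_upwards [isOpen_interior.mem_nhds hz] with w hw
    exact le_monomial_of_isGLB h hu (interior_subset hw)
  exact hne (exponent_eq_of_touching (hd.differentiableAt (by simp)) (hnear v hv) hvz.symm
    (hnear v' hv') hvz'.symm)

/-- A function that is approximated at each point by monomials lying above it on all of `Ω` is the
infimum of a family of monomials with at most one coefficient for each exponent: the least
coefficient for which the monomial lies above the function. -/
lemma exists_isGLB_monomial (hΩ : Ω.Nonempty) (h : ∀ z ∈ Ω, ∀ ε > 0, ∃ v b,
      (∀ w ∈ Ω, f w ≤ monomial v b w) ∧ monomial v b z < f z + ε) :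
    ∃ (A : Set (ℤ × ℤ)) (a : ℤ × ℤ → ℝ),
      ∀ z ∈ Ω, IsGLB ((fun v => monomial v (a v) z) '' A) (f z) := by
  set S : ℤ × ℤ → Set ℝ := fun v => {b | ∀ w ∈ Ω, f w ≤ monomial v b w}
  have hbdd : ∀ v, BddBelow (S v) := by
    intro v
    obtain ⟨w, hw⟩ := hΩ
    refine ⟨f w - monomial v 0 w, fun b hb => ?_⟩
    have := hb w hw
    rw [monomial_eq_add] at this
    linarith
  have hle : ∀ v, (S v).Nonempty → ∀ w ∈ Ω, f w ≤ monomial v (sInf (S v)) w := by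
    intro v hv w hw
    have : f w - monomial v 0 w ≤ sInf (S v) := le_csInf hv fun b hb => by
      have := hb w hw
      rw [monomial_eq_add] at this
      linarith
    rw [monomial_eq_add]
    linarith
  refine ⟨{v | (S v).Nonempty}, fun v => sInf (S v), fun z hz => ⟨?_, fun c hc => ?_⟩⟩
  · rintro _ ⟨v, hv, rfl⟩
    exact hle v hv z hz
  · refine le_of_forall_pos_le_add fun ε hε => ?_
    obtain ⟨v, b, hb, hlt⟩ := h z hz ε hε
    have h1 : c ≤ monomial v (sInf (S v)) z := hc ⟨v, ⟨b, hb⟩, rfl⟩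
    have h2 : sInf (S v) ≤ b := csInf_le (hbdd v) hb
    rw [monomial_eq_add] at h1 hlt
    linarith

end Series

/-! ### The minimal series through a finite set of points -/

lemma isClosed_halfPlanes (H : Finset ((ℤ × ℤ) × ℝ)) :
    IsClosed {z : Plane | ∀ h ∈ H, 0 ≤ monomial h.1 h.2 z} := by
  simp only [ofPred_forall]
  exact isClosed_biInter fun h _ => isClosed_le continuous_const (continuous_monomial _ _)

lemma exists_monomial_nonpos_of_mem_frontier (H : Finset ((ℤ × ℤ) × ℝ)) {z : Plane}
    (hz : z ∈ frontier {z : Plane | ∀ h ∈ H, 0 ≤ monomial h.1 h.2 z}) :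
    ∃ h ∈ H, monomial h.1 h.2 z ≤ 0 := by
  by_contra! hcon
  apply hz.2
  rw [mem_interior_iff_mem_nhds]
  have : ∀ᶠ w in 𝓝 z, ∀ h ∈ H, 0 < monomial h.1 h.2 w := by
    rw [Filter.eventually_all_finset]
    intro h hh
    exact continuousAt_const.eventually_lt (continuous_monomial _ _).continuousAt (hcon h hh)
  filter_upwards [this] with w hw h hh using (hw h hh).le

lemma monomial_nsmul (k : ℕ) (v : ℤ × ℤ) (b c : ℝ) (z : Plane) :
    monomial (k • v) (k * b + c) z = k * monomial v b z + c := by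
  simp only [monomial, Prod.smul_fst, Prod.smul_snd]
  push_cast [nsmul_eq_mul]
  ring

lemma mem_curve_of_two_active {Ω : Set Plane} {f : Plane → ℝ} {z : Plane} (hz : z ∈ interior Ω)
    {v v' : ℤ × ℤ} {a a' : ℝ} (hne : v ≠ v')
    (h : ∀ᶠ w in 𝓝 z, f w ≤ monomial v a w) (hv : f z = monomial v a z)
    (h' : ∀ᶠ w in 𝓝 z, f w ≤ monomial v' a' w) (hv' : f z = monomial v' a' z) :
    z ∈ curve Ω f :=
  ⟨hz, fun hd => hne (exponent_eq_of_touching (hd.differentiableAt (by simp)) h hv h' hv')⟩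

/-- There is a tropical series on a `ℚ`-polygon that is not smooth at each of finitely many given
interior points. With `ℓ` the minimum of the monomials cutting out the polygon, it is the infimum
of all monomials that lie above the concave function `∑ q ∈ P, min (ℓ z) (ℓ q)`. -/
lemma seriesThrough_nonempty {Δ : Set Plane} (hΔ : IsQPolygon Δ) (P : Finset Plane)
    (hP : (P : Set Plane) ⊆ interior Δ) : (seriesThrough Δ P).Nonempty := by
  classical
  obtain ⟨⟨H, Hne, Hnz, hH⟩, hint⟩ := hΔ
  have hΔne : Δ.Nonempty := hint.mono interior_subset
  set ℓ : Plane → ℝ := fun z => H.inf' Hne fun h => monomial h.1 h.2 z with hℓ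
  have hℓle : ∀ h ∈ H, ∀ z, ℓ z ≤ monomial h.1 h.2 z := fun h hh z => Finset.inf'_le _ hh
  have hℓ0 : ∀ z ∈ Δ, 0 ≤ ℓ z := by
    intro z hz
    rw [hH] at hz
    exact Finset.le_inf' _ _ hz
  set G : Plane → ℝ := fun z => ∑ q ∈ P, min (ℓ z) (ℓ q) with hG
  have hG0 : ∀ z ∈ Δ, 0 ≤ G z := fun z hz => Finset.sum_nonneg fun q hq =>
    le_min (hℓ0 z hz) (hℓ0 q (interior_subset (hP hq)))
  set S : Set ((ℤ × ℤ) × ℝ) := {m | ∀ w ∈ Δ, G w ≤ monomial m.1 m.2 w} with hS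
  -- replacing each term of the sum by one of its two arguments gives a monomial above `G`
  set mono : (ℤ × ℤ) × ℝ → (Plane → Prop) → (ℤ × ℤ) × ℝ := fun h R =>
    ((P.filter R).card • h.1,
      (P.filter R).card * h.2 + ∑ q ∈ P.filter (fun q => ¬ R q), ℓ q) with hmono
  have mono_apply : ∀ h R z, monomial (mono h R).1 (mono h R).2 z =
      ∑ q ∈ P, if R q then monomial h.1 h.2 z else ℓ q := by
    intro h R z
    rw [Finset.sum_ite, Finset.sum_const, nsmul_eq_mul]
    exact monomial_nsmul _ _ _ _ _
  have mono_mem : ∀ h ∈ H, ∀ R, mono h R ∈ S := by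
    intro h hh R w _
    rw [mono_apply]
    refine Finset.sum_le_sum fun q _ => ?_
    split_ifs
    · exact (min_le_left _ _).trans (hℓle h hh w)
    · exact min_le_right _ _
  obtain ⟨h₀, hh₀⟩ := Hne
  have hglb : ∀ z ∈ Δ, IsGLB ((fun m : (ℤ × ℤ) × ℝ => monomial m.1 m.2 z) '' S)
      (sInf ((fun m : (ℤ × ℤ) × ℝ => monomial m.1 m.2 z) '' S)) := fun z hz =>
    isGLB_csInf ⟨_, mem_image_of_mem _ (mono_mem h₀ hh₀ fun _ => True)⟩
      ⟨G z, by rintro _ ⟨m, hm, rfl⟩; exact hm z hz⟩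
  set g : Plane → ℝ := fun z => sInf ((fun m : (ℤ × ℤ) × ℝ => monomial m.1 m.2 z) '' S) with hg
  have hgle : ∀ m ∈ S, ∀ z ∈ Δ, g z ≤ monomial m.1 m.2 z := fun m hm z hz =>
    (hglb z hz).1 (mem_image_of_mem _ hm)
  have hGg : ∀ z ∈ Δ, G z ≤ g z := fun z hz =>
    (hglb z hz).2 (by rintro _ ⟨m, hm, rfl⟩; exact hm z hz)
  refine ⟨g, ⟨fun z hz => (hG0 z hz).trans (hGg z hz), fun z hz => ?_, ?_⟩, fun p hp => ?_⟩
  · have hzΔ : z ∈ Δ := by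
      have hcl : IsClosed Δ := hH ▸ isClosed_halfPlanes H
      exact hcl.frontier_subset hz
    rw [hH] at hz
    obtain ⟨h, hh, hle⟩ := exists_monomial_nonpos_of_mem_frontier H hz
    refine le_antisymm ((hgle _ (mono_mem h hh fun _ => True) z hzΔ).trans ?_)
      ((hG0 z hzΔ).trans (hGg z hzΔ))
    rw [mono_apply]
    exact Finset.sum_nonpos fun q _ => by simpa using hle
  · refine exists_isGLB_monomial hΔne fun z hz ε hε => ?_
    obtain ⟨_, ⟨m, hm, rfl⟩, -, hlt⟩ := (hglb z hz).exists_between (lt_add_of_pos_right (g z) hε)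
    exact ⟨m.1, m.2, hgle m hm, hlt⟩
  · have hpΔ : p ∈ Δ := interior_subset (hP hp)
    obtain ⟨h, hh, hhp⟩ := H.exists_mem_eq_inf' ⟨h₀, hh₀⟩ fun h => monomial h.1 h.2 p
    have hℓp : ℓ p = monomial h.1 h.2 p := hhp
    have hnear : ∀ R, ∀ᶠ w in 𝓝 p, g w ≤ monomial (mono h R).1 (mono h R).2 w := fun R => by
      filter_upwards [isOpen_interior.mem_nhds (hP hp)] with w hw
      exact hgle _ (mono_mem h hh R) w (interior_subset hw)
    have htouch : ∀ R : Plane → Prop, (∀ q, ℓ p < ℓ q → R q) → (∀ q, R q → ℓ p ≤ ℓ q) →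
        g p = monomial (mono h R).1 (mono h R).2 p := by
      intro R h1 h2
      refine le_antisymm (hgle _ (mono_mem h hh R) p hpΔ) ?_
      refine le_trans (le_of_eq ?_) (hGg p hpΔ)
      rw [mono_apply]
      refine Finset.sum_congr rfl fun q _ => ?_
      split_ifs with hR
      · rw [min_eq_left (h2 q hR), hℓp]
      · rw [min_eq_right (not_lt.1 fun h => hR (h1 q h))]
    refine mem_curve_of_two_active (hP hp) ?_ (hnear fun q => ℓ p < ℓ q)
      (htouch _ (fun q h => h) fun q h => h.le) (hnear fun q => ℓ p ≤ ℓ q)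
      (htouch _ (fun q h => h.le) fun q h => h)
    -- the two exponents are different multiples of that of `h`: they count `p` differently
    have hlt : (P.filter fun q => ℓ p < ℓ q).card < (P.filter fun q => ℓ p ≤ ℓ q).card := by
      apply Finset.card_lt_card
      refine Finset.ssubset_iff_of_subset
        (Finset.monotone_filter_right _ fun q _ h => le_of_lt h) |>.2 ⟨p, ?_, ?_⟩
      · exact Finset.mem_filter.2 ⟨hp, le_rfl⟩
      · simp
    intro heq
    have heq' : ((P.filter fun q => ℓ p < ℓ q).card : ℤ) • h.1 =
        ((P.filter fun q => ℓ p ≤ ℓ q).card : ℤ) • h.1 := by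
      rw [natCast_zsmul, natCast_zsmul]
      exact heq
    exact hlt.ne (by exact_mod_cast smul_left_injective ℤ (Hnz h hh) heq')

section MinSeries

variable {Ω P : Set Plane}

lemma minSeries_le {g : Plane → ℝ} (hg : g ∈ seriesThrough Ω P) {z : Plane} (hz : z ∈ Ω) :
    minSeries Ω P z ≤ g z :=
  csInf_le ⟨0, by rintro _ ⟨g, hg, rfl⟩; exact hg.1.1 z hz⟩ ⟨g, hg, rfl⟩

lemma isSeries_minSeries (hΩ : Ω.Nonempty) (hS : (seriesThrough Ω P).Nonempty) :
    IsSeries Ω (minSeries Ω P) := by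
  refine ⟨fun z hz => Real.sInf_nonneg ?_, fun z hz => ?_, ?_⟩
  · rintro _ ⟨g, hg, rfl⟩
    exact hg.1.1 z hz
  · have : (fun g : Plane → ℝ => g z) '' seriesThrough Ω P = {0} := by
      refine subset_antisymm ?_ ?_
      · rintro _ ⟨g, hg, rfl⟩
        exact hg.1.2.1 z hz
      · rintro _ rfl
        obtain ⟨g, hg⟩ := hS
        exact ⟨g, hg, hg.1.2.1 z hz⟩
    rw [minSeries, this, csInf_singleton]
  · refine exists_isGLB_monomial hΩ fun z hz ε hε => ?_
    obtain ⟨_, ⟨g, hg, rfl⟩, hlt⟩ :=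
      exists_lt_of_csInf_lt (hS.image _) (lt_add_of_pos_right (minSeries Ω P z) hε)
    obtain ⟨A, a, hA⟩ := hg.1.2.2
    obtain ⟨_, ⟨v, hv, rfl⟩, -, hvlt⟩ := (hA z hz).exists_between hlt
    exact ⟨v, a v, fun w hw => (minSeries_le hg hw).trans (le_monomial_of_isGLB hA hv hw), hvlt⟩

/-- Singularities survive in the infimum. If the infimum were a single monomial on a disc around
`p`, then each monomial above it with another exponent would exceed it at `p` by a fixed amount,
because the difference has a non-zero integral gradient; but a series through `p` with value close
to the infimum has two active monomials at `p`. -/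
lemma subset_curve_minSeries (hP : P ⊆ interior Ω) (hS : (seriesThrough Ω P).Nonempty) :
    P ⊆ curve Ω (minSeries Ω P) := by
  intro p hp
  refine ⟨hP hp, fun hd => ?_⟩
  obtain ⟨v, b, hvb⟩ := exists_eventuallyEq_monomial
    (isSeries_minSeries ⟨p, interior_subset (hP hp)⟩ hS) (hP hp) hd
  obtain ⟨r, hr, hball⟩ := Metric.eventually_nhds_iff_ball.1
    (hvb.and (isOpen_interior.mem_nhds (hP hp)))
  obtain ⟨_, ⟨g, hg, rfl⟩, hlt⟩ :=
    exists_lt_of_csInf_lt (hS.image _) (lt_add_of_pos_right (minSeries Ω P p) (half_pos hr))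
  obtain ⟨g0, -, A, a, hA⟩ := hg.1
  obtain ⟨u, hu, u', hu', hne, hup, hup'⟩ := exists_two_active hA g0 (hP hp) (by
    rintro ⟨w, c, hw⟩
    exact (hg.2 hp).2 ((contDiff_monomial w c).contDiffAt.congr_of_eventuallyEq hw))
  obtain ⟨n, hn, hnp, hnv⟩ : ∃ n ∈ A, monomial n (a n) p = g p ∧ n ≠ v := by
    by_cases huv : u = v
    · exact ⟨u', hu', hup', fun h => hne (huv.trans h.symm)⟩
    · exact ⟨u, hu, hup, huv⟩
  obtain ⟨i, hi⟩ : ∃ i, intVec n i ≠ intVec v i := by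
    by_contra! hcon
    exact hnv (intVec_injective hcon)
  have h1 := abs_slope_mul_le (v := n - v) (a := a n - b) hr (fun w hw => by
    rw [← monomial_sub_monomial, ← (hball w hw).1, sub_nonneg]
    have hwΩ := interior_subset (hball w hw).2
    exact (minSeries_le hg hwΩ).trans (le_monomial_of_isGLB hA hn hwΩ)) i
  have h2 : (1 : ℝ) ≤ |intVec (n - v) i| := by
    obtain ⟨k, hk⟩ := intVec_apply_eq_intCast (n - v) i
    have : k ≠ 0 := by
      rintro rfl
      rw [intVec_sub_apply, Int.cast_zero] at hk
      exact hi (sub_eq_zero.1 hk)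
    rw [hk, ← Int.cast_abs]
    exact_mod_cast Int.one_le_abs this
  rw [← monomial_sub_monomial, ← (hball p (Metric.mem_ball_self hr)).1, hnp] at h1
  nlinarith

end MinSeries

/-! ### Edges -/

lemma IsSeries.concaveOn {Ω : Set Plane} {f : Plane → ℝ} (hf : IsSeries Ω f)
    (hΩ : Convex ℝ Ω) : ConcaveOn ℝ Ω f := by
  obtain ⟨-, -, A, a, h⟩ := hf
  refine ⟨hΩ, fun z hz w hw s t hs ht hst => (h _ (hΩ hz hw hs ht hst)).2 ?_⟩
  rintro _ ⟨v, hv, rfl⟩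
  have hzv := mul_le_mul_of_nonneg_left (le_monomial_of_isGLB h hv hz) hs
  have hwv := mul_le_mul_of_nonneg_left (le_monomial_of_isGLB h hv hw) ht
  simp only [monomial_combo v (a v) z w hst, smul_eq_mul]
  linarith

/-- The points of `Ω` near which `f` is, up to a constant, the minimum of the two linear functions
with exponents `v` and `v'`. For `v ≠ v'` the non-empty sets of this form are the edges of the
curve of `f`. -/
def pairEdge (Ω : Set Plane) (f : Plane → ℝ) (v v' : ℤ × ℤ) : Set Plane :=
  {z | z ∈ interior Ω ∧
    ∀ᶠ δ in 𝓝 (0 : Plane), f (z + δ) = f z + min (monomial v 0 δ) (monomial v' 0 δ)}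

section PairEdge

variable {Ω : Set Plane} {f : Plane → ℝ} {v v' : ℤ × ℤ} {z : Plane}

lemma monomial_zero_right (v : ℤ × ℤ) : monomial v 0 0 = 0 := by simp [monomial]

lemma monomial_add_exponent (v u : ℤ × ℤ) (m : ℕ) (δ : Plane) :
    monomial (v + m • u) 0 δ = monomial v 0 δ + m * monomial u 0 δ := by
  simp only [monomial, Prod.fst_add, Prod.snd_add, Prod.smul_fst, Prod.smul_snd]
  push_cast [nsmul_eq_mul]
  ring

lemma monomial_sub (v : ℤ × ℤ) (z w : Plane) :
    monomial v 0 (z - w) = monomial v 0 z - monomial v 0 w := by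
  simp only [monomial, PiLp.sub_apply]; ring

/-- A property holding at small translates of `z` holds near `z`. -/
lemma eventually_nhds_of_translate {p : Plane → Prop} (h : ∀ᶠ δ in 𝓝 (0 : Plane), p (z + δ)) :
    ∀ᶠ w in 𝓝 z, p w := by
  have ht : Filter.Tendsto (fun w => w - z) (𝓝 z) (𝓝 0) := by
    have : ContinuousAt (fun w : Plane => w - z) z := by fun_prop
    simpa [ContinuousAt] using this
  filter_upwards [ht.eventually h] with w hw
  simpa using hw

lemma eventually_translate_of_nhds {p : Plane → Prop} (h : ∀ᶠ w in 𝓝 z, p w) :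
    ∀ᶠ δ in 𝓝 (0 : Plane), p (z + δ) := by
  have ht : Filter.Tendsto (fun δ => z + δ) (𝓝 (0 : Plane)) (𝓝 z) := by
    have : ContinuousAt (fun δ : Plane => z + δ) 0 := by fun_prop
    simpa [ContinuousAt] using this
  exact ht.eventually h

/-- A property of small vectors holds for `t • x` for some `t` in `(0, 1)`. -/
lemma exists_smul_of_eventually {p : Plane → Prop} (h : ∀ᶠ δ in 𝓝 (0 : Plane), p δ) (x : Plane) :
    ∃ t : ℝ, 0 < t ∧ t < 1 ∧ p (t • x) := by
  have ht : Filter.Tendsto (fun t : ℝ => t • x) (𝓝 0) (𝓝 0) := by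
    have : ContinuousAt (fun t : ℝ => t • x) 0 := by fun_prop
    simpa [ContinuousAt] using this
  have h1 : ∀ᶠ t in 𝓝[>] (0 : ℝ), p (t • x) := (ht.eventually h).filter_mono nhdsWithin_le_nhds
  have h2 : ∀ᶠ t in 𝓝[>] (0 : ℝ), t ∈ Ioo (0 : ℝ) 1 := Ioo_mem_nhdsGT one_pos
  obtain ⟨t, ht, ht'⟩ := (h1.and h2).exists
  exact ⟨t, ht'.1, ht'.2, ht⟩

lemma le_add_min_of_mem_pairEdge (hf : ConcaveOn ℝ Ω f) (hz : z ∈ pairEdge Ω f v v') {w : Plane}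
    (hw : w ∈ Ω) : f w ≤ f z + min (monomial v 0 (w - z)) (monomial v' 0 (w - z)) := by
  obtain ⟨t, ht0, ht1, ht⟩ := exists_smul_of_eventually hz.2 (w - z)
  have hc := hf.2 (interior_subset hz.1) hw (sub_nonneg.2 ht1.le) ht0.le (sub_add_cancel 1 t)
  have e : (1 - t) • z + t • w = z + t • (w - z) := by module
  rw [e, ht, monomial_smul, monomial_smul, ← mul_min_of_nonneg _ _ ht0.le] at hc
  simp only [smul_eq_mul] at hc
  nlinarith

lemma monomial_sub_eq_of_mem_pairEdge (hf : ConcaveOn ℝ Ω f) (hz : z ∈ pairEdge Ω f v v')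
    {w : Plane} (hw : w ∈ pairEdge Ω f v v') :
    monomial v 0 (w - z) = f w - f z ∧ monomial v' 0 (w - z) = f w - f z := by
  have h1 := le_add_min_of_mem_pairEdge hf hz (interior_subset hw.1)
  have h2 := le_add_min_of_mem_pairEdge hf hw (interior_subset hz.1)
  have e : ∀ u, monomial u 0 (z - w) = - monomial u 0 (w - z) := fun u => by
    rw [monomial_sub, monomial_sub]; ring
  rw [e, e] at h2
  have a1 := min_le_left (monomial v 0 (w - z)) (monomial v' 0 (w - z))
  have a2 := min_le_right (monomial v 0 (w - z)) (monomial v' 0 (w - z))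
  have b1 := min_le_left (-monomial v 0 (w - z)) (-monomial v' 0 (w - z))
  have b2 := min_le_right (-monomial v 0 (w - z)) (-monomial v' 0 (w - z))
  constructor <;> linarith

/-- By concavity, the points with a given pair of exponents form a convex set. -/
lemma convex_pairEdge (hf : ConcaveOn ℝ Ω f) : Convex ℝ (pairEdge Ω f v v') := by
  intro z hz w hw s t hs ht hst
  obtain rfl : s = 1 - t := by linarith
  have hint : (1 - t) • z + t • w ∈ interior Ω := hf.1.interior hz.1 hw.1 hs ht hst
  obtain ⟨e1, e2⟩ := monomial_sub_eq_of_mem_pairEdge hf hz hw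
  have key : ∀ᶠ δ in 𝓝 (0 : Plane), f ((1 - t) • z + t • w + δ) =
      (1 - t) * f z + t * f w + min (monomial v 0 δ) (monomial v' 0 δ) := by
    filter_upwards [hz.2, hw.2,
      eventually_translate_of_nhds (isOpen_interior.mem_nhds hint),
      eventually_translate_of_nhds (isOpen_interior.mem_nhds hz.1),
      eventually_translate_of_nhds (isOpen_interior.mem_nhds hw.1)] with δ h1 h2 h3 h4 h5
    apply le_antisymm
    · have := le_add_min_of_mem_pairEdge hf hz (interior_subset h3)
      have e : (1 - t) • z + t • w + δ - z = t • (w - z) + δ := by module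
      rw [e, monomial_add, monomial_add, monomial_smul, monomial_smul, e1, e2, ← add_min] at this
      linarith
    · have := hf.2 (interior_subset h4) (interior_subset h5) hs ht hst
      have e : (1 - t) • (z + δ) + t • (w + δ) = (1 - t) • z + t • w + δ := by module
      rw [e, h1, h2] at this
      simp only [smul_eq_mul] at this
      linarith
  refine ⟨hint, ?_⟩
  have h0 := key.self_of_nhds
  simp only [add_zero, monomial_zero_right, min_self] at h0
  filter_upwards [key] with δ hδ
  rw [hδ, h0]

/-- The two exponents are determined by `f` up to order. -/
lemma exponents_eq_of_mem_pairEdge {w w' : ℤ × ℤ} (h : z ∈ pairEdge Ω f v v')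
    (h' : z ∈ pairEdge Ω f w w') : v = w ∧ v' = w' ∨ v = w' ∧ v' = w := by
  have key : ∀ x : Plane, min (monomial v 0 x) (monomial v' 0 x) =
      min (monomial w 0 x) (monomial w' 0 x) := by
    intro x
    obtain ⟨t, ht0, -, h1, h2⟩ := exists_smul_of_eventually (h.2.and h'.2) x
    have := h1.symm.trans h2
    simp only [monomial_smul, ← mul_min_of_nonneg _ _ ht0.le] at this
    exact mul_left_cancel₀ ht0.ne' (by linarith)
  -- the directions `±(1, 0)`, `±(0, 1)` and `±(1, 1)` suffice to compare the pairs of exponents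
  have keyZ : ∀ p q : ℤ, min (v.1 * p + v.2 * q) (v'.1 * p + v'.2 * q) =
      min (w.1 * p + w.2 * q) (w'.1 * p + w'.2 * q) := by
    intro p q
    have := key !₂[(p : ℝ), (q : ℝ)]
    simp only [monomial, Matrix.cons_val_zero, Matrix.cons_val_one,
      add_zero] at this
    exact_mod_cast this
  have pair : ∀ {a b c d : ℤ}, min a b = min c d → min (-a) (-b) = min (-c) (-d) →
      a = c ∧ b = d ∨ a = d ∧ b = c := by omega
  have k1 := pair (by simpa using keyZ 1 0) (by simpa using keyZ (-1) 0)
  have k2 := pair (by simpa using keyZ 0 1) (by simpa using keyZ 0 (-1))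
  have k3 := pair (by simpa using keyZ 1 1) (by
    have := keyZ (-1) (-1)
    simp only [mul_neg, mul_one, ← neg_add] at this
    exact this)
  simp only [Prod.ext_iff]
  clear key keyZ pair
  omega

lemma pairEdge_subset_curve (hne : v ≠ v') : pairEdge Ω f v v' ⊆ curve Ω f := by
  intro z hz
  have hnear : ∀ᶠ w in 𝓝 z, f w = f z +
      min (monomial v 0 (w - z)) (monomial v' 0 (w - z)) :=
    eventually_nhds_of_translate (by simpa using hz.2)
  have e : ∀ u w, monomial u (f z - monomial u 0 z) w = f z + monomial u 0 (w - z) := fun u w => by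
    rw [monomial_eq_add, monomial_sub]; ring
  refine mem_curve_of_two_active hz.1 hne (a := f z - monomial v 0 z) (a' := f z - monomial v' 0 z)
    ?_ ?_ ?_ ?_
  · filter_upwards [hnear] with w hw
    rw [e, hw]
    gcongr
    exact min_le_left _ _
  · rw [e]; simp [monomial_zero_right]
  · filter_upwards [hnear] with w hw
    rw [e, hw]
    gcongr
    exact min_le_right _ _
  · rw [e]; simp [monomial_zero_right]

lemma hasWeightAt_of_mem_pairEdge {m : ℕ} {u : ℤ × ℤ} (hu : IsCoprime u.1 u.2)
    (hne : v ≠ v + m • u) (hz : z ∈ pairEdge Ω f v (v + m • u)) : HasWeightAt Ω f m z := by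
  refine ⟨pairEdge_subset_curve hne hz, u, v, -monomial u 0 z, f z - monomial v 0 z, hu, ?_⟩
  apply eventually_nhds_of_translate
  filter_upwards [hz.2] with δ hδ
  have h1 : monomial u (-monomial u 0 z) (z + δ) = monomial u 0 δ := by
    rw [monomial_add, monomial_eq_add]; ring
  have h2 : monomial v (f z - monomial v 0 z) (z + δ) = f z + monomial v 0 δ := by
    rw [monomial_add, monomial_eq_add]; ring
  rw [hδ, h1, h2, monomial_add_exponent, min_add, ← add_assoc, zero_add, add_min]
  congr 1
  ring

lemma HasWeightAt.exists_mem_pairEdge {m : ℕ} (h : HasWeightAt Ω f m z) :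
    0 < m ∧ ∃ v u : ℤ × ℤ, IsCoprime u.1 u.2 ∧ z ∈ pairEdge Ω f v (v + m • u) := by
  obtain ⟨⟨hz, hns⟩, u, v, e, k, hu, hev⟩ := h
  have hsm : ∀ w c, ¬ f =ᶠ[𝓝 z] monomial w c := fun w c hw =>
    hns ((contDiff_monomial w c).contDiffAt.congr_of_eventuallyEq hw)
  have hm : 0 < m := by
    rw [Nat.pos_iff_ne_zero]
    rintro rfl
    apply hsm v k
    filter_upwards [hev] with w hw
    simpa using hw
  -- away from the zero line of the monomial `u, e` the function would be smooth
  have h0 : monomial u e z = 0 := by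
    rcases lt_trichotomy (monomial u e z) 0 with hlt | h0 | hgt
    · exfalso
      apply hsm (v + m • u) (m * e + k)
      filter_upwards [hev, (continuous_monomial u e).continuousAt.eventually_lt
        continuousAt_const hlt] with w hw hw'
      rw [hw, min_eq_right (mul_nonpos_of_nonneg_of_nonpos (Nat.cast_nonneg m) hw'.le),
        monomial_eq_add (v + m • u), monomial_add_exponent, monomial_eq_add u e,
        monomial_eq_add v k]
      ring
    · exact h0
    · exfalso
      apply hsm v k
      filter_upwards [hev, continuousAt_const.eventually_lt
        (continuous_monomial u e).continuousAt hgt] with w hw hw'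
      rw [hw, min_eq_left (mul_nonneg (Nat.cast_nonneg m) hw'.le), zero_add]
  refine ⟨hm, v, u, hu, hz, ?_⟩
  have hfz := hev.self_of_nhds
  simp only [h0, mul_zero, min_self, zero_add] at hfz
  filter_upwards [eventually_translate_of_nhds hev] with δ hδ
  rw [hδ, monomial_add, h0, zero_add, monomial_add, hfz, monomial_add_exponent]
  rcases le_total 0 (m * monomial u 0 δ) with h | h
  · rw [min_eq_left h, min_eq_left (by linarith)]; ring
  · rw [min_eq_right h, min_eq_right (by linarith)]; ring

/-- Any two distinct exponents differ by a positive multiple of a primitive vector. -/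
lemma exists_primitive_of_ne (hne : v ≠ v') :
    ∃ (m : ℕ) (u : ℤ × ℤ), 0 < m ∧ IsCoprime u.1 u.2 ∧ v' = v + m • u := by
  have hpos : 0 < (v'.1 - v.1).gcd (v'.2 - v.2) := by
    rw [Nat.pos_iff_ne_zero, Ne, Int.gcd_eq_zero_iff]
    rintro ⟨h1, h2⟩
    exact hne (Prod.ext (by omega) (by omega))
  obtain ⟨p, q, hpq, h1, h2⟩ := Int.exists_gcd_one hpos
  refine ⟨_, (p, q), hpos, Int.isCoprime_iff_gcd_eq_one.2 hpq, Prod.ext ?_ ?_⟩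
  · simp only [Prod.fst_add, Prod.smul_fst]
    rw [nsmul_eq_mul]
    linarith
  · simp only [Prod.snd_add, Prod.smul_snd]
    rw [nsmul_eq_mul]
    linarith

lemma ne_add_nsmul {m : ℕ} (hm : 0 < m) {u : ℤ × ℤ} (hu : IsCoprime u.1 u.2) : v ≠ v + m • u := by
  intro h
  have : m • u = 0 := by simpa using h
  rcases smul_eq_zero.1 this with h | rfl
  · exact hm.ne' h
  · exact not_isCoprime_zero_zero hu

lemma mem_edgePoints_iff : z ∈ edgePoints Ω f ↔ ∃ v v', v ≠ v' ∧ z ∈ pairEdge Ω f v v' := by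
  constructor
  · rintro ⟨m, -, h⟩
    obtain ⟨hm, v, u, hu, hz⟩ := h.exists_mem_pairEdge
    exact ⟨v, _, ne_add_nsmul hm hu, hz⟩
  · rintro ⟨v, v', hne, hz⟩
    obtain ⟨m, u, hm, hu, rfl⟩ := exists_primitive_of_ne hne
    exact ⟨m, hm, hasWeightAt_of_mem_pairEdge hu hne hz⟩

/-- Along the line on which the two linear functions agree, the points near a point of an edge
belong to the same edge; off this line the function is smooth. -/
lemma eventually_mem_pairEdge (hz : z ∈ pairEdge Ω f v v') : ∀ᶠ w in 𝓝 z,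
    (monomial v 0 (w - z) = monomial v' 0 (w - z) → w ∈ pairEdge Ω f v v') ∧
      (w ∈ edgePoints Ω f → w ∈ pairEdge Ω f v v') := by
  have hnear : ∀ᶠ w in 𝓝 z, f w = f z +
      min (monomial v 0 (w - z)) (monomial v' 0 (w - z)) :=
    eventually_nhds_of_translate (by simpa using hz.2)
  filter_upwards [hnear.eventually_nhds, isOpen_interior.mem_nhds hz.1] with w hw hwint
  have h1 : monomial v 0 (w - z) = monomial v' 0 (w - z) → w ∈ pairEdge Ω f v v' := by
    intro heq
    refine ⟨hwint, ?_⟩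
    filter_upwards [eventually_translate_of_nhds hw] with δ hδ
    rw [hδ, hw.self_of_nhds, add_sub_right_comm, monomial_add, monomial_add, heq, min_self,
      min_add_add_left]
    ring
  refine ⟨h1, fun hwe => h1 ?_⟩
  obtain ⟨m, -, ⟨-, hns⟩, -⟩ := hwe
  have hsm : ∀ u c, ¬ f =ᶠ[𝓝 w] monomial u c := fun u c hw =>
    hns ((contDiff_monomial u c).contDiffAt.congr_of_eventuallyEq hw)
  have e : ∀ u x, monomial u (f z - monomial u 0 z) x = f z + monomial u 0 (x - z) := fun u x => by
    rw [monomial_eq_add, monomial_sub]; ring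
  have hcont : ∀ u, ContinuousAt (fun x => monomial u 0 (x - z)) w := fun u =>
    ((continuous_monomial u 0).comp (continuous_id.sub continuous_const)).continuousAt
  rcases lt_trichotomy (monomial v 0 (w - z)) (monomial v' 0 (w - z)) with hlt | heq | hlt
  · exfalso
    apply hsm v (f z - monomial v 0 z)
    filter_upwards [hw, (hcont v).eventually_lt (hcont v') hlt] with x hx hx'
    rw [hx, e, min_eq_left hx'.le]
  · exact heq
  · exfalso
    apply hsm v' (f z - monomial v' 0 z)
    filter_upwards [hw, (hcont v').eventually_lt (hcont v) hlt] with x hx hx'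
    rw [hx, e, min_eq_right hx'.le]

lemma connectedComponentIn_edgePoints (hf : ConcaveOn ℝ Ω f) (hne : v ≠ v')
    (hz : z ∈ pairEdge Ω f v v') :
    connectedComponentIn (edgePoints Ω f) z = pairEdge Ω f v v' := by
  have hsub : pairEdge Ω f v v' ⊆ edgePoints Ω f := fun w hw =>
    mem_edgePoints_iff.2 ⟨v, v', hne, hw⟩
  refine subset_antisymm ?_
    ((convex_pairEdge hf).isPreconnected.subset_connectedComponentIn hz hsub)
  -- `pairEdge` and its complement in `edgePoints` are both relatively open
  set C := connectedComponentIn (edgePoints Ω f) z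
  have hC : C ⊆ edgePoints Ω f := connectedComponentIn_subset _ _
  set U := {w | ∀ᶠ x in 𝓝 w, x ∈ edgePoints Ω f → x ∈ pairEdge Ω f v v'}
  set V := {w | ∀ᶠ x in 𝓝 w, x ∈ edgePoints Ω f → x ∉ pairEdge Ω f v v'}
  have hU : IsOpen U := isOpen_iff_mem_nhds.2 fun w hw => Filter.Eventually.eventually_nhds hw
  have hV : IsOpen V := isOpen_iff_mem_nhds.2 fun w hw => Filter.Eventually.eventually_nhds hw
  have hUV : C ⊆ U ∪ V := by
    intro w hw
    obtain ⟨p, p', -, hp⟩ := mem_edgePoints_iff.1 (hC hw)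
    by_cases hwv : w ∈ pairEdge Ω f v v'
    · left
      filter_upwards [eventually_mem_pairEdge hwv] with x hx using hx.2
    · right
      filter_upwards [eventually_mem_pairEdge hp] with x hx hxe hxv
      apply hwv
      rcases exponents_eq_of_mem_pairEdge hxv (hx.2 hxe) with ⟨rfl, rfl⟩ | ⟨rfl, rfl⟩
      · exact hp
      · simpa only [pairEdge, min_comm] using hp
  have hdis : C ∩ (U ∩ V) = ∅ := by
    rw [Set.eq_empty_iff_forall_notMem]
    rintro w ⟨hw, hwU, hwV⟩
    exact Filter.Eventually.self_of_nhds hwV (hC hw) (Filter.Eventually.self_of_nhds hwU (hC hw))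
  rcases isPreconnected_iff_subset_of_disjoint.1 isPreconnected_connectedComponentIn U V hU hV
    hUV hdis with h | h
  · exact fun w hw => Filter.Eventually.self_of_nhds (h hw) (hC hw)
  · have hzC : z ∈ C := mem_connectedComponentIn (hsub hz)
    exact absurd hz (Filter.Eventually.self_of_nhds (h hzC) (hC hzC))

lemma mem_edges_iff (hf : ConcaveOn ℝ Ω f) {L : Set Plane} : L ∈ edges Ω f ↔
    ∃ v v', v ≠ v' ∧ L.Nonempty ∧ L = pairEdge Ω f v v' := by
  constructor
  · rintro ⟨z, hz, rfl⟩
    obtain ⟨v, v', hne, hzv⟩ := mem_edgePoints_iff.1 hz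
    exact ⟨v, v', hne, ⟨z, mem_connectedComponentIn hz⟩,
      connectedComponentIn_edgePoints hf hne hzv⟩
  · rintro ⟨v, v', hne, ⟨z, hz⟩, rfl⟩
    exact ⟨z, mem_edgePoints_iff.2 ⟨v, v', hne, hz⟩,
      (connectedComponentIn_edgePoints hf hne hz).symm⟩

/-- The weight of an edge is the lattice length of the difference of its two exponents. -/
lemma edgeWeight_pairEdge {m : ℕ} (hm : 0 < m) {u : ℤ × ℤ} (hu : IsCoprime u.1 u.2)
    (hL : (pairEdge Ω f v (v + m • u)).Nonempty) :
    edgeWeight Ω f (pairEdge Ω f v (v + m • u)) = m := by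
  have : {k : ℕ | ∀ z ∈ pairEdge Ω f v (v + m • u), HasWeightAt Ω f k z} = {m} := by
    refine subset_antisymm (fun k hk => ?_) ?_
    · obtain ⟨z, hz⟩ := hL
      obtain ⟨hk0, w, x, hx, hzw⟩ := (hk z hz).exists_mem_pairEdge
      have hgcd : ∀ (n : ℕ) (y : ℤ × ℤ), IsCoprime y.1 y.2 → (n * y.1).gcd (n * y.2) = n :=
        fun n y hy => by
          rw [Int.gcd_mul_left, Int.isCoprime_iff_gcd_eq_one.1 hy, Int.natAbs_natCast, mul_one]
      have h1 := hgcd m u hu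
      have h2 := hgcd k x hx
      rcases exponents_eq_of_mem_pairEdge hz hzw with ⟨rfl, h⟩ | ⟨rfl, h⟩
      · have h : m • u = k • x := by simpa using h
        have e1 := congrArg Prod.fst h
        have e2 := congrArg Prod.snd h
        simp only [Prod.smul_fst, Prod.smul_snd] at e1 e2
        rw [nsmul_eq_mul, nsmul_eq_mul] at e1 e2
        rw [e1, e2] at h1
        exact h2.symm.trans h1
      · have h : m • u = -(k • x) := by
          have : k • x + m • u = 0 := by simpa [add_assoc] using h
          exact (neg_eq_of_add_eq_zero_right this).symm
        have e1 := congrArg Prod.fst h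
        have e2 := congrArg Prod.snd h
        simp only [Prod.fst_neg, Prod.snd_neg, Prod.smul_fst, Prod.smul_snd] at e1 e2
        rw [nsmul_eq_mul, nsmul_eq_mul] at e1 e2
        rw [e1, e2, Int.gcd_neg, Int.neg_gcd] at h1
        exact h2.symm.trans h1
    · rintro _ rfl z hz
      exact hasWeightAt_of_mem_pairEdge hu (ne_add_nsmul hm hu) hz
  rw [edgeWeight, this, csInf_singleton]

end PairEdge

/-! ### The area of an edge -/

lemma natAbs_eq_of_isCoprime {a b c d : ℤ} (h : IsCoprime a b) (h' : IsCoprime c d)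
    (e : a * c = -(b * d)) : a.natAbs = d.natAbs ∧ c.natAbs = b.natAbs := by
  have had : a ∣ d := h.dvd_of_dvd_mul_left (by rw [← dvd_neg, ← e]; exact dvd_mul_right a c)
  have hda : d ∣ a := h'.symm.dvd_of_dvd_mul_right (by rw [e, dvd_neg]; exact dvd_mul_left d b)
  have hcb : c ∣ b := h'.dvd_of_dvd_mul_right (by rw [← dvd_neg, ← e]; exact dvd_mul_left c a)
  have hbc : b ∣ c := h.symm.dvd_of_dvd_mul_left (by rw [e, dvd_neg]; exact dvd_mul_right b d)
  exact ⟨Int.natAbs_eq_of_dvd_dvd had hda, Int.natAbs_eq_of_dvd_dvd hcb hbc⟩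

lemma norm_intVec_sq (v : ℤ × ℤ) : ‖intVec v‖ ^ 2 = (v.1 : ℝ) ^ 2 + (v.2 : ℝ) ^ 2 := by
  simp [EuclideanSpace.real_norm_sq_eq, intVec]

section EdgeArea

variable {Ω : Set Plane} {f : Plane → ℝ} {v v' : ℤ × ℤ} {z : Plane}

/-- An edge is the image of a set of real numbers under the parametrization of its line by a
primitive vector. -/
lemma pairEdge_eq_lineMap_image (hf : ConcaveOn ℝ Ω f) {m : ℕ} (hm : 0 < m) {u : ℤ × ℤ}
    (hu : IsCoprime u.1 u.2) (hz : z ∈ pairEdge Ω f v (v + m • u)) :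
    pairEdge Ω f v (v + m • u) = AffineMap.lineMap (k := ℝ) z (z + intVec (-u.2, u.1)) ''
      (AffineMap.lineMap (k := ℝ) z (z + intVec (-u.2, u.1)) ⁻¹' pairEdge Ω f v (v + m • u)) := by
  refine (image_preimage_eq_of_subset fun x hx => ?_).symm
  obtain ⟨e1, e2⟩ := monomial_sub_eq_of_mem_pairEdge hf hz hx
  rw [monomial_add_exponent, e1] at e2
  have h0 : monomial u 0 (x - z) = 0 := by
    have hm' : (m : ℝ) ≠ 0 := by exact_mod_cast hm.ne'
    have : (m : ℝ) * monomial u 0 (x - z) = 0 := by linarith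
    exact (mul_eq_zero.1 this).resolve_left hm'
  have hpos : (u.1 : ℝ) ^ 2 + (u.2 : ℝ) ^ 2 ≠ 0 := by
    intro h
    have h' : u.1 ^ 2 + u.2 ^ 2 = 0 := by exact_mod_cast h
    have h1 : u.1 = 0 := by nlinarith [sq_nonneg u.1, sq_nonneg u.2]
    have h2 : u.2 = 0 := by nlinarith [sq_nonneg u.1, sq_nonneg u.2]
    rw [h1, h2] at hu
    exact not_isCoprime_zero_zero hu
  simp only [monomial, PiLp.sub_apply, add_zero] at h0
  refine ⟨(-u.2 * (x 0 - z 0) + u.1 * (x 1 - z 1)) / ((u.1 : ℝ) ^ 2 + (u.2 : ℝ) ^ 2), ?_⟩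
  ext i
  rw [AffineMap.lineMap_apply]
  fin_cases i
  · simp [intVec]
    field_simp
    linear_combination (-u.1 : ℝ) * h0
  · simp [intVec]
    field_simp
    linear_combination (-u.2 : ℝ) * h0

lemma isPrimitiveDirection_pairEdge (hf : ConcaveOn ℝ Ω f) {m : ℕ} (hm : 0 < m) {u : ℤ × ℤ}
    (hu : IsCoprime u.1 u.2) :
    IsPrimitiveDirection (pairEdge Ω f v (v + m • u)) (-u.2, u.1) := by
  refine ⟨hu.symm.neg_left, fun x hx y hy => ?_⟩
  rw [pairEdge_eq_lineMap_image hf hm hu hx] at hy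
  obtain ⟨t, -, rfl⟩ := hy
  exact ⟨t, by simp [AffineMap.lineMap_apply]⟩

lemma norm_intVec_of_isPrimitiveDirection {u : ℤ × ℤ} (hu : IsCoprime u.1 u.2) {m : ℕ}
    (hz : z ∈ pairEdge Ω f v (v + m • u)) {p : ℤ × ℤ}
    (hp : IsPrimitiveDirection (pairEdge Ω f v (v + m • u)) p) :
    ‖intVec p‖ = ‖intVec (-u.2, u.1)‖ := by
  obtain ⟨t, ht, -, h⟩ := exists_smul_of_eventually
    (eventually_translate_of_nhds (eventually_mem_pairEdge hz)) (intVec (-u.2, u.1))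
  have hmem := h.1 (by
    rw [add_sub_cancel_left, monomial_add_exponent, monomial_smul u]
    simp [monomial, intVec]
    right; right
    ring)
  obtain ⟨s, hs⟩ := hp.2 z hz _ hmem
  rw [add_sub_cancel_left] at hs
  have h0 : t * -(u.2 : ℝ) = s * p.1 := by simpa [intVec] using congrArg (fun x : Plane => x 0) hs
  have h1 : t * (u.1 : ℝ) = s * p.2 := by simpa [intVec] using congrArg (fun x : Plane => x 1) hs
  have hprod : u.1 * p.1 = -(u.2 * p.2) := by
    have : t * ((u.1 : ℝ) * p.1) = t * -((u.2 : ℝ) * p.2) := by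
      linear_combination (p.1 : ℝ) * h1 - (p.2 : ℝ) * h0
    exact_mod_cast mul_left_cancel₀ ht.ne' this
  obtain ⟨e1, e2⟩ := natAbs_eq_of_isCoprime hu hp.1 hprod
  have e1' : (u.1 : ℝ) ^ 2 = (p.2 : ℝ) ^ 2 := by exact_mod_cast Int.natAbs_eq_iff_sq_eq.1 e1
  have e2' : (p.1 : ℝ) ^ 2 = (u.2 : ℝ) ^ 2 := by exact_mod_cast Int.natAbs_eq_iff_sq_eq.1 e2
  have hsq : ‖intVec p‖ ^ 2 = ‖intVec (-u.2, u.1)‖ ^ 2 := by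
    rw [norm_intVec_sq, norm_intVec_sq, e2', ← e1']
    push_cast
    ring
  exact (sq_eq_sq₀ (norm_nonneg _) (norm_nonneg _)).1 hsq

/-- The weighted area of an edge is the sum over the two coordinates of the jump of the partial
derivative across the edge times the length of the projection along that coordinate. -/
lemma intervalArea_mul_edgeWeight (hf : ConcaveOn ℝ Ω f) (hne : v ≠ v')
    (hL : (pairEdge Ω f v v').Nonempty) :
    intervalArea (pairEdge Ω f v v') * (edgeWeight Ω f (pairEdge Ω f v v') : ℝ≥0∞) =
      ∑ i : Fin 2, ENNReal.ofReal |intVec v i - intVec v' i| *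
        volume ((fun z : Plane => z (1 - i)) '' pairEdge Ω f v v') := by
  obtain ⟨m, u, hm, hu, rfl⟩ := exists_primitive_of_ne hne
  rw [edgeWeight_pairEdge hm hu hL]
  obtain ⟨z, hz⟩ := hL
  set w := intVec (-u.2, u.1) with hw
  have hint : intervalArea (pairEdge Ω f v (v + m • u)) =
      μH[1] (pairEdge Ω f v (v + m • u)) * ‖w‖ₑ := by
    refine le_antisymm (iInf₂_le _ (isPrimitiveDirection_pairEdge hf hm hu))
      (le_iInf₂ fun p hp => le_of_eq ?_)
    rw [← ofReal_norm, ← ofReal_norm, norm_intVec_of_isPrimitiveDirection hu hz hp]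
  rw [hint]
  have himg := pairEdge_eq_lineMap_image hf hm hu hz
  set J := AffineMap.lineMap (k := ℝ) z (z + w) ⁻¹' pairEdge Ω f v (v + m • u)
  have hH : μH[1] (pairEdge Ω f v (v + m • u)) = ENNReal.ofReal ‖w‖ * volume J := by
    conv_lhs => rw [himg]
    rw [hausdorffMeasure_lineMap_image, hausdorffMeasure_real, ENNReal.smul_def, smul_eq_mul,
      ← ENNReal.ofReal_coe_nnreal, coe_nndist, dist_self_add_right]
  have hproj : ∀ j : Fin 2, volume ((fun z : Plane => z j) '' pairEdge Ω f v (v + m • u)) =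
      ENNReal.ofReal |w j| * volume J := by
    intro j
    have e : (fun z : Plane => z j) '' pairEdge Ω f v (v + m • u) =
        AffineMap.lineMap (k := ℝ) (z j) (z j + w j) '' J := by
      conv_lhs => rw [himg]
      rw [image_image]
      refine image_congr fun t _ => ?_
      simp [AffineMap.lineMap_apply, hw]
    rw [e, ← hausdorffMeasure_real, hausdorffMeasure_lineMap_image, ENNReal.smul_def, smul_eq_mul,
      ← ENNReal.ofReal_coe_nnreal, coe_nndist, dist_self_add_right, Real.norm_eq_abs]
  have hjump : ∀ i, |intVec v i - intVec (v + m • u) i| = m * |intVec u i| := by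
    intro i
    have : intVec v i - intVec (v + m • u) i = -(m * intVec u i) := by
      fin_cases i <;> simp [intVec]
    rw [this, abs_neg, abs_mul, Nat.abs_cast]
  have hw2 : ‖w‖ * ‖w‖ = |intVec u 0| * |w 1| + |intVec u 1| * |w 0| := by
    rw [← sq, hw, norm_intVec_sq]
    simp only [intVec, Matrix.cons_val_zero, Matrix.cons_val_one, Int.cast_neg, abs_neg,
      abs_mul_abs_self]
    ring
  rw [hH, Fin.sum_univ_two, hjump, hjump, hproj, hproj, ← ofReal_norm, ← ENNReal.ofReal_natCast]
  have e : ENNReal.ofReal ‖w‖ * volume J * ENNReal.ofReal ‖w‖ * ENNReal.ofReal m =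
      ENNReal.ofReal (m * (‖w‖ * ‖w‖)) * volume J := by
    rw [ENNReal.ofReal_mul (by positivity), ENNReal.ofReal_mul (by positivity)]
    ring
  rw [e, hw2, mul_add, ENNReal.ofReal_add (by positivity) (by positivity), add_mul]
  simp only [sub_zero, sub_self, ← mul_assoc]
  rw [← ENNReal.ofReal_mul (by positivity), ← ENNReal.ofReal_mul (by positivity)]

end EdgeArea

/-! ### Slicing the curve by coordinate lines -/

section Slices

variable {Ω : Set Plane} {f : Plane → ℝ} {A : Set (ℤ × ℤ)} {a : ℤ × ℤ → ℝ} {v v' : ℤ × ℤ}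
  {z : Plane}

/-- The supergradients of the slice of `f` along the `i`-th coordinate direction at height `y`:
the slopes `σ` for which `f - σ zᵢ` takes, at an interior point of the slice, a value larger than
its boundary values, `f` being understood to vanish on the boundary. -/
def slopeSet (Ω : Set Plane) (f : Plane → ℝ) (i : Fin 2) (y : ℝ) : Set ℝ :=
  {σ | ∃ z ∈ interior Ω, z (1 - i) = y ∧
    ∀ z' ∈ frontier Ω, z' (1 - i) = y → σ * (z i - z' i) < f z}

lemma slopeSet_mono {g : Plane → ℝ} (h : ∀ z ∈ Ω, f z ≤ g z) (i : Fin 2) (y : ℝ) :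
    slopeSet Ω f i y ⊆ slopeSet Ω g i y := by
  rintro σ ⟨z, hz, hzy, hσ⟩
  exact ⟨z, hz, hzy, fun z' hz' hy => (hσ z' hz' hy).trans_le (h z (interior_subset hz))⟩

lemma monomial_of_slice (u : ℤ × ℤ) {i : Fin 2} {δ : Plane} (h : δ (1 - i) = 0) :
    monomial u 0 δ = intVec u i * δ i := by
  fin_cases i
  · have : δ 1 = 0 := h
    simp [monomial, intVec, this]
  · have : δ 0 = 0 := h
    simp [monomial, intVec, this]

lemma ext_of_slice {i : Fin 2} {x z : Plane} (h : x (1 - i) = z (1 - i)) (h' : x i = z i) :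
    x = z := by
  ext j
  fin_cases i <;> fin_cases j
  exacts [h', h, h, h']

/-- A point of an edge is the strict maximum of `f - σ zᵢ` on its slice, for every `σ` strictly
between the slopes on the two sides of the edge. -/
lemma lt_of_mem_pairEdge_of_slice (hf : ConcaveOn ℝ Ω f) (hz : z ∈ pairEdge Ω f v v') {i : Fin 2}
    {σ : ℝ} (hσ : σ ∈ Ioo (min (intVec v i) (intVec v' i)) (max (intVec v i) (intVec v' i)))
    {x : Plane} (hx : x ∈ Ω) (hxz : x (1 - i) = z (1 - i)) (hne : x ≠ z) :
    f x < f z + σ * (x i - z i) := by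
  have h0 : (x - z) (1 - i) = 0 := by rw [PiLp.sub_apply, hxz, sub_self]
  have hle := le_add_min_of_mem_pairEdge hf hz hx
  rw [monomial_of_slice v h0, monomial_of_slice v' h0, PiLp.sub_apply] at hle
  have hd : x i - z i ≠ 0 := fun h => hne (ext_of_slice hxz (sub_eq_zero.1 h))
  obtain ⟨h1, h2⟩ := hσ
  refine hle.trans_lt ?_
  gcongr
  rw [min_lt_iff] at h1 ⊢
  rw [lt_max_iff] at h2
  rcases hd.lt_or_gt with hd | hd
  · exact h2.imp (fun h => mul_lt_mul_of_neg_right h hd) fun h => mul_lt_mul_of_neg_right h hd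
  · exact h1.imp (fun h => mul_lt_mul_of_pos_right h hd) fun h => mul_lt_mul_of_pos_right h hd

lemma mem_slopeSet_of_mem_pairEdge (hcl : IsClosed Ω) (hfr : ∀ z ∈ frontier Ω, f z = 0)
    (hf : ConcaveOn ℝ Ω f) (hz : z ∈ pairEdge Ω f v v') {i : Fin 2} {σ : ℝ}
    (hσ : σ ∈ Ioo (min (intVec v i) (intVec v' i)) (max (intVec v i) (intVec v' i))) :
    σ ∈ slopeSet Ω f i (z (1 - i)) := by
  refine ⟨z, hz.1, rfl, fun z' hz' hy => ?_⟩
  have := lt_of_mem_pairEdge_of_slice hf hz hσ (hcl.frontier_subset hz') hy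
    (by rintro rfl; exact hz'.2 hz.1)
  rw [hfr z' hz'] at this
  linarith

/-- The points at which three of the monomials `monomial p (a p)` with non-collinear exponents take
the same value. For `f` an infimum of such monomials, the vertices of its curve are among them. -/
def tripleSet (a : ℤ × ℤ → ℝ) : Set Plane :=
  {z | ∃ p q r : ℤ × ℤ, (q.1 - p.1) * (r.2 - p.2) - (q.2 - p.2) * (r.1 - p.1) ≠ 0 ∧
    monomial q (a q) z = monomial p (a p) z ∧ monomial r (a r) z = monomial p (a p) z}

lemma countable_tripleSet (a : ℤ × ℤ → ℝ) : (tripleSet a).Countable := by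
  have : tripleSet a = ⋃ t : (ℤ × ℤ) × (ℤ × ℤ) × (ℤ × ℤ),
      {z | (t.2.1.1 - t.1.1) * (t.2.2.2 - t.1.2) - (t.2.1.2 - t.1.2) * (t.2.2.1 - t.1.1) ≠ 0 ∧
        monomial t.2.1 (a t.2.1) z = monomial t.1 (a t.1) z ∧
        monomial t.2.2 (a t.2.2) z = monomial t.1 (a t.1) z} := by
    ext z
    simp only [tripleSet, mem_ofPred_eq, mem_iUnion, Prod.exists]
  rw [this]
  refine countable_iUnion fun ⟨p, q, r⟩ => Set.Subsingleton.countable ?_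
  rintro z ⟨hd, h1, h2⟩ w ⟨-, h3, h4⟩
  have hd' : ((q.1 : ℝ) - p.1) * (r.2 - p.2) - (q.2 - p.2) * (r.1 - p.1) ≠ 0 := by
    exact_mod_cast hd
  simp only [monomial] at h1 h2 h3 h4
  ext j
  fin_cases j
  · apply mul_left_cancel₀ hd'
    simp only [Fin.zero_eta]
    linear_combination ((r.2 : ℝ) - p.2) * (h1 - h3) - ((q.2 : ℝ) - p.2) * (h2 - h4)
  · apply mul_left_cancel₀ hd'
    simp only [Fin.mk_one]
    linear_combination ((q.1 : ℝ) - p.1) * (h2 - h4) - ((r.1 : ℝ) - p.1) * (h1 - h3)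

lemma upperSemicontinuousOn_of_isGLB
    (h : ∀ z ∈ Ω, IsGLB ((fun v => monomial v (a v) z) '' A) (f z)) :
    UpperSemicontinuousOn f Ω := by
  intro z hz c hc
  obtain ⟨_, ⟨v, hv, rfl⟩, -, hlt⟩ := (h z hz).exists_between hc
  filter_upwards [self_mem_nhdsWithin, mem_nhdsWithin_of_mem_nhds
    ((continuous_monomial v (a v)).continuousAt.eventually_lt continuousAt_const hlt)] with w hw hlt
  exact (le_monomial_of_isGLB h hv hw).trans_lt hlt

/-- A linear function whose exponent lies on the segment between two others is at least the
minimum of the two. -/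
lemma min_le_monomial_of_collinear {p q r : ℤ × ℤ} {i : Fin 2}
    (hdet : (q.1 - p.1) * (r.2 - p.2) - (q.2 - p.2) * (r.1 - p.1) = 0)
    (hqp : intVec q i < intVec p i) (hqr : intVec q i ≤ intVec r i)
    (hrp : intVec r i ≤ intVec p i) (δ : Plane) :
    min (monomial p 0 δ) (monomial q 0 δ) ≤ monomial r 0 δ := by
  have hdet' : ((q.1 : ℝ) - p.1) * (r.2 - p.2) - (q.2 - p.2) * (r.1 - p.1) = 0 := by
    exact_mod_cast hdet
  have key : (intVec p i - intVec q i) * monomial r 0 δ =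
      (intVec r i - intVec q i) * monomial p 0 δ + (intVec p i - intVec r i) * monomial q 0 δ := by
    fin_cases i
    · simp [monomial, intVec]
      linear_combination (-δ 1) * hdet'
    · simp [monomial, intVec]
      linear_combination (δ 0) * hdet'
  have h1 := mul_le_mul_of_nonneg_left (min_le_left (monomial p 0 δ) (monomial q 0 δ))
    (sub_nonneg.2 hqr)
  have h2 := mul_le_mul_of_nonneg_left (min_le_right (monomial p 0 δ) (monomial q 0 δ))
    (sub_nonneg.2 hrp)
  refine le_of_mul_le_mul_left ?_ (sub_pos.2 hqp)
  rw [key]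
  linarith

/-- For a non-integral slope `σ` of a generic slice, the maximum of `f - σ zᵢ` on the slice is
attained on an edge, and `σ` lies strictly between the slopes on the two sides of it. -/
lemma exists_mem_pairEdge_of_mem_slopeSet (hc : IsCompact Ω)
    (h : ∀ z ∈ Ω, IsGLB ((fun v => monomial v (a v) z) '' A) (f z))
    (h0 : ∀ z ∈ Ω, 0 ≤ f z) (hfr : ∀ z ∈ frontier Ω, f z = 0) {i : Fin 2} {y σ : ℝ}
    (hy : y ∉ (fun z : Plane => z (1 - i)) '' tripleSet a) (hσ : σ ∉ range ((↑) : ℤ → ℝ))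
    (hmem : σ ∈ slopeSet Ω f i y) :
    ∃ z p q, z ∈ pairEdge Ω f p q ∧ z (1 - i) = y ∧ intVec q i < σ ∧ σ < intVec p i := by
  obtain ⟨z₀, hz₀, hzy₀, hσz₀⟩ := hmem
  -- a maximum point `z` of `f - σ zᵢ` on the slice
  obtain ⟨z, ⟨hzΩ, hzy⟩, hmax⟩ : ∃ z ∈ Ω ∩ {z : Plane | z (1 - i) = y},
      IsMaxOn (fun z : Plane => f z + -(σ * z i)) (Ω ∩ {z : Plane | z (1 - i) = y}) z := by
    refine UpperSemicontinuousOn.exists_isMaxOn ⟨z₀, interior_subset hz₀, hzy₀⟩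
      (hc.inter_right (isClosed_eq (by fun_prop) continuous_const)) ?_
    refine ((upperSemicontinuousOn_of_isGLB h).mono inter_subset_left).add ?_
    have hcont : Continuous fun z : Plane => -(σ * z i) := by fun_prop
    exact hcont.upperSemicontinuous.upperSemicontinuousOn _
  have hmax' : ∀ w ∈ Ω, w (1 - i) = y → f w - f z ≤ σ * (w i - z i) := by
    intro w hw hwy
    have : f w + -(σ * w i) ≤ f z + -(σ * z i) := hmax ⟨hw, hwy⟩
    linarith
  have hz : z ∈ interior Ω := by
    by_contra hzn
    have hzf : z ∈ frontier Ω := ⟨subset_closure hzΩ, hzn⟩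
    have h1 := hσz₀ z hzf hzy
    have h2 := hmax' z₀ (interior_subset hz₀) hzy₀
    rw [hfr z hzf] at h2
    linarith
  obtain ⟨F, hF, hev⟩ := exists_finite_active h h0 hz
  have hev' := eventually_translate_of_nhds (hev.and (isOpen_interior.mem_nhds hz))
  -- in each of the two directions along the slice some active monomial stays below slope `σ`
  have hdir : ∀ s : ℝ, s ≠ 0 → ∃ v ∈ F, intVec v i * s ≤ σ * s := by
    intro s hs
    obtain ⟨t, ht, -, ⟨v, hvF, hv⟩, hint⟩ := exists_smul_of_eventually hev'
      (EuclideanSpace.single i s)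
    refine ⟨v, hvF, ?_⟩
    rw [monomial_add, (hF v hvF).2, monomial_smul, monomial_single] at hv
    have hji : (1 - i : Fin 2) ≠ i := by fin_cases i <;> decide
    have := hmax' (z + t • EuclideanSpace.single i s) (interior_subset hint) (by
      simpa [hji] using hzy)
    rw [← hv] at this
    simp at this
    refine le_of_mul_le_mul_left (a := t) ?_ ht
    linarith
  have hFne : F.Nonempty := by
    obtain ⟨v, hv, -⟩ := hdir 1 one_ne_zero
    exact ⟨v, hv⟩
  have hne : ∀ v, intVec v i ≠ σ := by
    rintro v rfl
    obtain ⟨n, hn⟩ := intVec_apply_eq_intCast v i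
    exact hσ ⟨n, hn.symm⟩
  obtain ⟨p, hpF, hp⟩ := F.exists_max_image (fun v => intVec v i) hFne
  obtain ⟨q, hqF, hq⟩ := F.exists_min_image (fun v => intVec v i) hFne
  have hσp : σ < intVec p i := by
    obtain ⟨v, hvF, hv⟩ := hdir (-1) (by norm_num)
    exact (lt_of_le_of_ne (by linarith) (hne v).symm).trans_le (hp v hvF)
  have hqσ : intVec q i < σ := by
    obtain ⟨v, hvF, hv⟩ := hdir 1 one_ne_zero
    exact (hq v hvF).trans_lt (lt_of_le_of_ne (by linarith) (hne v))
  refine ⟨z, p, q, ⟨hz, ?_⟩, hzy, hqσ, hσp⟩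
  filter_upwards [hev'] with δ ⟨⟨r, hrF, hr⟩, hint⟩
  have hle : ∀ v ∈ F, f (z + δ) ≤ f z + monomial v 0 δ := fun v hv => by
    rw [← (hF v hv).2, ← monomial_add]
    exact le_monomial_of_isGLB h (hF v hv).1 (interior_subset hint)
  apply le_antisymm
  · rw [add_min]
    exact le_min (hle p hpF) (hle q hqF)
  · rw [← hr, monomial_add, (hF r hrF).2]
    gcongr
    refine min_le_monomial_of_collinear ?_ (hqσ.trans hσp) (hq r hrF) (hp r hrF) δ
    by_contra hdet
    exact hy ⟨z, ⟨p, q, r, hdet, (hF q hqF).2.trans (hF p hpF).2.symm,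
      (hF r hrF).2.trans (hF p hpF).2.symm⟩, hzy⟩

end Slices

/-! ### The area formula -/

section Area

variable {Ω : Set Plane} {f : Plane → ℝ}

/-- A generic slice has total slope variation equal to the sum of the jumps of the partial
derivative at the edges that it meets: the slope intervals of these edges are disjoint and fill
the set of supergradients up to integers. -/
lemma volume_slopeSet (hc : IsCompact Ω) (hΩ : Convex ℝ Ω) (hf : IsSeries Ω f)
    {A : Set (ℤ × ℤ)} {a : ℤ × ℤ → ℝ}
    (h : ∀ z ∈ Ω, IsGLB ((fun v => monomial v (a v) z) '' A) (f z))
    [Countable (edges Ω f)] (p q : edges Ω f → ℤ × ℤ)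
    (hpq : ∀ L : edges Ω f, L.1 = pairEdge Ω f (p L) (q L)) {i : Fin 2} {y : ℝ}
    (hy : y ∉ (fun z : Plane => z (1 - i)) '' tripleSet a) :
    volume (slopeSet Ω f i y) = ∑' L : edges Ω f, ((fun z : Plane => z (1 - i)) '' L.1).indicator
      (fun _ => ENNReal.ofReal |intVec (p L) i - intVec (q L) i|) y := by
  classical
  have hconc := hf.concaveOn hΩ
  set B : edges Ω f → Set ℝ := fun L => if y ∈ (fun z : Plane => z (1 - i)) '' L.1 then
    Ioo (min (intVec (p L) i) (intVec (q L) i)) (max (intVec (p L) i) (intVec (q L) i)) else ∅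
  have hB : ∀ {L σ}, σ ∈ B L → ∃ z ∈ pairEdge Ω f (p L) (q L), z (1 - i) = y ∧
      σ ∈ Ioo (min (intVec (p L) i) (intVec (q L) i)) (max (intVec (p L) i) (intVec (q L) i)) := by
    intro L σ hσ
    by_cases hL : y ∈ (fun z : Plane => z (1 - i)) '' L.1
    · simp only [B, if_pos hL] at hσ
      obtain ⟨z, hz, hzy⟩ := hL
      exact ⟨z, hpq L ▸ hz, hzy, hσ⟩
    · simp only [B, if_neg hL, mem_empty_iff_false] at hσ
  have hvol : ∀ L, volume (B L) = ((fun z : Plane => z (1 - i)) '' L.1).indicator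
      (fun _ => ENNReal.ofReal |intVec (p L) i - intVec (q L) i|) y := by
    intro L
    by_cases hL : y ∈ (fun z : Plane => z (1 - i)) '' L.1
    · rw [indicator_of_mem hL]
      simp only [B, if_pos hL]
      rw [Real.volume_Ioo, max_sub_min_eq_abs']
    · rw [indicator_of_notMem hL]
      simp only [B, if_neg hL, measure_empty]
  have hdisj : Pairwise (Function.onFun Disjoint B) := by
    intro L L' hne
    refine Set.disjoint_left.2 fun σ hσ hσ' => hne ?_
    obtain ⟨z, hz, hzy, hσz⟩ := hB hσ
    obtain ⟨z', hz', hzy', hσz'⟩ := hB hσ'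
    -- the strict maximum point on the slice is unique
    obtain rfl : z = z' := by
      by_contra hzz
      have h1 := lt_of_mem_pairEdge_of_slice hconc hz hσz (interior_subset hz'.1)
        (hzy'.trans hzy.symm) (Ne.symm hzz)
      have h2 := lt_of_mem_pairEdge_of_slice hconc hz' hσz' (interior_subset hz.1)
        (hzy.trans hzy'.symm) hzz
      linarith
    apply Subtype.ext
    rw [hpq L, hpq L']
    rcases exponents_eq_of_mem_pairEdge hz hz' with ⟨e1, e2⟩ | ⟨e1, e2⟩
    · rw [e1, e2]
    · simp only [e1, e2, pairEdge, min_comm]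
  have hmeas : ∀ L, MeasurableSet (B L) := by
    intro L
    simp only [B]
    split_ifs
    exacts [measurableSet_Ioo, MeasurableSet.empty]
  simp only [← hvol]
  rw [← measure_iUnion hdisj hmeas]
  refine le_antisymm ?_ (measure_mono (iUnion_subset fun L σ hσ => ?_))
  · have hsub : slopeSet Ω f i y ⊆ (⋃ L, B L) ∪ range ((↑) : ℤ → ℝ) := by
      intro σ hσ
      by_cases hσZ : σ ∈ range ((↑) : ℤ → ℝ)
      · exact Or.inr hσZ
      left
      obtain ⟨z, v, v', hz, hzy, hlt, hgt⟩ :=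
        exists_mem_pairEdge_of_mem_slopeSet hc h hf.1 hf.2.1 hy hσZ hσ
      have hne : v ≠ v' := by
        rintro rfl
        linarith
      have hL : pairEdge Ω f v v' ∈ edges Ω f :=
        (mem_edges_iff hconc).2 ⟨v, v', hne, ⟨z, hz⟩, rfl⟩
      refine mem_iUnion.2 ⟨⟨_, hL⟩, ?_⟩
      simp only [B]
      rw [if_pos ⟨z, hz, hzy⟩]
      have hz' : z ∈ pairEdge Ω f (p ⟨_, hL⟩) (q ⟨_, hL⟩) := hpq ⟨_, hL⟩ ▸ hz
      rcases exponents_eq_of_mem_pairEdge hz hz' with ⟨e1, e2⟩ | ⟨e1, e2⟩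
      · rw [← e1, ← e2]
        exact ⟨(min_le_right _ _).trans_lt hlt, hgt.trans_le (le_max_left _ _)⟩
      · rw [← e1, ← e2]
        exact ⟨(min_le_left _ _).trans_lt hlt, hgt.trans_le (le_max_right _ _)⟩
    refine (measure_mono hsub).trans ((measure_union_le _ _).trans ?_)
    rw [(countable_range _).measure_zero, add_zero]
  · obtain ⟨z, hz, rfl, hσz⟩ := hB hσ
    exact mem_slopeSet_of_mem_pairEdge hc.isClosed hf.2.1 hconc hz hσz

/-- The tropical symplectic area is the total mass of the Laplacian, computed by slicing: the sum
over the two coordinate directions of the integral of the total slope variation of the slices. -/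
theorem area_eq_sum_lintegral_slopeSet (hc : IsCompact Ω) (hΩ : Convex ℝ Ω) (hf : IsSeries Ω f) :
    area Ω f = ∑ i : Fin 2, ∫⁻ y, volume (slopeSet Ω f i y) := by
  have hconc := hf.concaveOn hΩ
  obtain ⟨A, a, h⟩ := hf.2.2
  choose p q hne hL hpq using fun L : edges Ω f => (mem_edges_iff hconc).1 L.2
  have : Countable (edges Ω f) := by
    refine Function.Injective.countable (f := fun L => (p L, q L)) fun L L' hLL => ?_
    obtain ⟨e1, e2⟩ := Prod.ext_iff.1 hLL
    apply Subtype.ext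
    rw [hpq L, hpq L']
    simp only at e1 e2
    rw [e1, e2]
  have hslice : ∀ i, ∫⁻ y, volume (slopeSet Ω f i y) = ∑' L : edges Ω f,
      ENNReal.ofReal |intVec (p L) i - intVec (q L) i| *
        volume ((fun z : Plane => z (1 - i)) '' L.1) := by
    intro i
    have hmeas : ∀ L : edges Ω f, MeasurableSet ((fun z : Plane => z (1 - i)) '' L.1) := by
      intro L
      have hconv : Convex ℝ (pairEdge Ω f (p L) (q L)) := convex_pairEdge hconc
      rw [hpq L]
      have hproj := hconv.linear_image
        (EuclideanSpace.proj (𝕜 := ℝ) (1 - i) : Plane →L[ℝ] ℝ).toLinearMap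
      exact hproj.ordConnected.measurableSet
    have hae : ∀ᵐ y : ℝ, volume (slopeSet Ω f i y) = ∑' L : edges Ω f,
        ((fun z : Plane => z (1 - i)) '' L.1).indicator
          (fun _ => ENNReal.ofReal |intVec (p L) i - intVec (q L) i|) y := by
      filter_upwards [((countable_tripleSet a).image fun z : Plane => z (1 - i)).ae_notMem volume]
        with y hy
      exact volume_slopeSet hc hΩ hf h p q hpq hy
    rw [lintegral_congr_ae hae, lintegral_tsum fun L =>
      (measurable_const.indicator (hmeas L)).aemeasurable]
    exact tsum_congr fun L => lintegral_indicator_const (hmeas L) _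
  rw [Fin.sum_univ_two, hslice, hslice, ← ENNReal.tsum_add]
  refine tsum_congr fun L => ?_
  have := intervalArea_mul_edgeWeight hconc (hne L) (hpq L ▸ hL L)
  rw [← hpq L, Fin.sum_univ_two] at this
  exact this

lemma area_mono (hc : IsCompact Ω) (hΩ : Convex ℝ Ω) {g : Plane → ℝ} (hf : IsSeries Ω f)
    (hg : IsSeries Ω g) (h : ∀ z ∈ Ω, f z ≤ g z) : area Ω f ≤ area Ω g := by
  rw [area_eq_sum_lintegral_slopeSet hc hΩ hf, area_eq_sum_lintegral_slopeSet hc hΩ hg]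
  exact Finset.sum_le_sum fun i _ => lintegral_mono fun y => measure_mono (slopeSet_mono h i y)

lemma IsQPolygon.convex (hΩ : IsQPolygon Ω) : Convex ℝ Ω := by
  obtain ⟨⟨H, -, -, rfl⟩, -⟩ := hΩ
  intro z hz w hw s t hs ht hst h hh
  rw [monomial_combo _ _ _ _ hst]
  exact add_nonneg (mul_nonneg hs (hz h hh)) (mul_nonneg ht (hw h hh))

end Area

end TropicalSeries

open TropicalSeries in
theorem mainTheorem5 (Δ : Set Plane) (hΔ : IsQPolygon Δ) (hc : IsCompact Δ)
    (P : Finset Plane) (hP : (P : Set Plane) ⊆ interior Δ) :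
    IsSeries Δ (minSeries Δ P) ∧
      (P : Set Plane) ⊆ curve Δ (minSeries Δ P) ∧
      ∀ g : Plane → ℝ, IsSeries Δ g → (P : Set Plane) ⊆ curve Δ g →
        area Δ (minSeries Δ P) ≤ area Δ g := by
  have hS := seriesThrough_nonempty hΔ P hP
  have hmin := isSeries_minSeries (hΔ.2.mono interior_subset) hS
  exact ⟨hmin, subset_curve_minSeries hP hS, fun g hg hPg =>
    area_mono hc hΔ.convex hmin hg fun z hz => minSeries_le ⟨hg, hPg⟩ hz⟩
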